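/- For integers $n \ge 1$ and $k \ge 3$, let $f(n,k)$ denote the maximum, over all (finite, simple) planar graphs $G$ on $n$ vertices, of the number of (not necessarily induced) subgraphs of $G$ that are isomorphic to the cycle $C_k$ of length $k$. Then for every fixed $k \ge 3$, $$f(n,k) = \Theta\bigl(n^{\lfloor k/2 \rfloor}\bigr) \qquad (n \to \infty),$$ where the constants implied by the $\Theta$-notation may depend on $k$. -/

import Mathlib

open Asymptotics

/-- A drawing of the simple graph `G` in the plane without crossings: the vertices are distinct
points, each edge is a simple arc joining its two endpoints, an arc contains no vertices other than
its endpoints, and the arcs of two distinct edges meet only at a common endpoint. -/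
structure SimpleGraph.PlaneEmbedding {V : Type*} (G : SimpleGraph V) where
  /-- The point at which a vertex is placed. -/
  point : V → ℝ × ℝ
  /-- A parametrization of the arc which represents an edge. -/
  arc : G.edgeSet → unitInterval → ℝ × ℝ
  point_injective : Function.Injective point
  arc_continuous : ∀ e, Continuous (arc e)
  arc_injective : ∀ e, Function.Injective (arc e)
  arc_ends : ∀ e, s(arc e 0, arc e 1) = Sym2.map point e.1
  vertex_on_arc : ∀ e t w, arc e t = point w → w ∈ e.1
  arc_inter_arc : ∀ e e', e ≠ e' → ∀ t t', arc e t = arc e' t' →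
    ∃ w, w ∈ e.1 ∧ w ∈ e'.1 ∧ arc e t = point w

/-- A graph is planar if it can be drawn in the plane without crossings. -/
def SimpleGraph.IsPlanar {V : Type*} (G : SimpleGraph V) : Prop :=
  Nonempty G.PlaneEmbedding

open Classical in
/-- The maximum number of copies of `H` in an `n`-vertex planar graph, where a copy of `H` in `G`
is a (not necessarily induced) subgraph of `G` isomorphic to `H`. The edgeless graph is planar, so
this is a maximum over a nonempty finite set of graphs. -/
noncomputable def SimpleGraph.planarMaxCopies {W : Type*} (n : ℕ) (H : SimpleGraph W) : ℕ :=
  (Finset.univ.filter fun G : SimpleGraph (Fin n) => G.IsPlanar).sup fun G => G.copyCount H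

/-! Upper bound. Planarity is weakened to a property that contractions preserve: the paths of
vertex-disjoint edges are disjoint (`HasWeakDrawing`). `K₅` has no such drawing, by a winding-number
count modulo 4 (`not_exists_drawing_five`), and a graph with more than 7 edges per non-isolated
vertex has a `K₅` minor (`MinorClosed.exists_clique`). So planar graphs are 14-degenerate. Order the
vertices so that each has at most 14 later neighbours. In a copy of `C_k`, every vertex that is not
a local minimum of the order is one of at most 14 later neighbours of an adjacent vertex of the
copy, so the copy is fixed, up to boundedly many choices, by its local minima. These form an
independent set, of size at most `k / 2`, which leaves `O(n ^ (k / 2))` copies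
(`labelledCopyCount_le`).

Lower bound. Blow up alternate vertices of a cycle: consecutive hubs get `t` common neighbours, and
an edge joins the first and last hubs to close odd cycles. Independent choices of the common
neighbours give `t ^ (k / 2)` cycles with distinct vertex sets. Planarity comes from an explicit
drawing by graphs of functions. -/

/-! ### Nonplanarity of `K₅` by winding numbers -/

instance unitInterval.contractibleSpace : ContractibleSpace unitInterval :=
  (convex_Icc (0 : ℝ) 1).contractibleSpace ⟨0, by simp⟩

instance unitInterval.locallyPathConnectedSpace : LocallyPathConnectedSpace unitInterval := by
  have h : Topology.IsQuotientMap (Set.projIcc (0 : ℝ) 1 zero_le_one) :=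
    Topology.IsQuotientMap.of_inverse continuous_subtype_val continuous_projIcc
      (Set.projIcc_val zero_le_one)
  exact h.locallyPathConnectedSpace

open unitInterval in
/-- The variation of the logarithm of `γ - x` along `γ` does not depend on the branch. -/
theorem exists_log_variation (γ : C(I, ℂ)) (x : ℂ) (hx : ∀ t, γ t ≠ x) :
    ∃ w : ℂ, Complex.exp w * (γ 0 - x) = γ 1 - x ∧
      ∀ (l : C(I, ℂ)) (c : ℂ), (∀ t, Complex.exp (l t) = c * (γ t - x)) → l 1 - l 0 = w := by
  have h0 : ∀ t, γ t - x ≠ 0 := fun t => sub_ne_zero.2 (hx t)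
  have hcov := Complex.isCoveringMapOn_exp
  obtain ⟨L, hL, -⟩ := hcov.existsUnique_continuousMap_lifts
    (f := ⟨fun t => γ t - x, by fun_prop⟩) (a₀ := (0 : I)) (e₀ := Complex.log (γ 0 - x))
    (by simp [Complex.exp_log (h0 0)]) (by simpa using h0)
  have hL' : ∀ t, Complex.exp (L t) = γ t - x := fun t => congrFun hL.2 t
  refine ⟨L 1 - L 0, ?_, fun l c hl => ?_⟩
  · rw [← hL' 0, ← hL' 1, ← Complex.exp_add]; ring_nf
  · have key : (fun t => L t + (l 0 - L 0)) = fun t => l t := by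
      refine Complex.isCoveringMap_exp.eq_of_comp_eq (by fun_prop) (by fun_prop) ?_ 0 (by simp)
      funext t
      apply Subtype.ext
      simp only [Function.comp_apply]
      rw [hl t, Complex.exp_add, Complex.exp_sub, hL', hL', hl 0]
      field_simp [h0 0]
    rw [← show L 1 + (l 0 - L 0) = l 1 from congrFun key 1]; ring

open unitInterval in
/-- If two arcs are disjoint, then the variations of the argument around their four ends cancel. -/
theorem log_variation_of_disjoint (γ δ : C(I, ℂ)) (h : ∀ s t, γ s ≠ δ t) :
    ∃ lc ld la lb : C(I, ℂ),
      (∀ t, Complex.exp (lc t) = 1 * (γ t - δ 0)) ∧ (∀ t, Complex.exp (ld t) = 1 * (γ t - δ 1)) ∧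
      (∀ t, Complex.exp (la t) = (-1) * (δ t - γ 0)) ∧
      (∀ t, Complex.exp (lb t) = (-1) * (δ t - γ 1)) ∧
      (lc 1 - lc 0) - (ld 1 - ld 0) + (lb 1 - lb 0) - (la 1 - la 0) = 0 := by
  have h0 : ∀ s t, γ s - δ t ≠ 0 := fun s t => sub_ne_zero.2 (h s t)
  -- The difference `γ s - δ t` has a logarithm on the whole square; the four variations are its
  -- increments along the sides, which sum to zero around the boundary.
  obtain ⟨L, hL, -⟩ := Complex.isCoveringMapOn_exp.existsUnique_continuousMap_lifts
    (f := ⟨fun z : I × I => γ z.1 - δ z.2, by fun_prop⟩) (a₀ := ((0 : I), (0 : I)))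
    (e₀ := Complex.log (γ 0 - δ 0))
    (by simp [Complex.exp_log (h0 0 0)]) (by simpa using h0)
  have hL' : ∀ s t, Complex.exp (L (s, t)) = γ s - δ t := fun s t => congrFun hL.2 (s, t)
  refine ⟨⟨fun s => L (s, 0), by fun_prop⟩, ⟨fun s => L (s, 1), by fun_prop⟩,
    ⟨fun t => L (0, t), by fun_prop⟩, ⟨fun t => L (1, t), by fun_prop⟩, ?_, ?_, ?_, ?_, ?_⟩
  · simp [hL']
  · simp [hL']
  · simp [hL']
  · simp [hL']
  · simp only [ContinuousMap.coe_mk]; ring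

open unitInterval in
/-- In every drawing of `K₅` in the plane, some two independent edges meet. -/
theorem not_exists_drawing_five (p : Fin 5 → ℂ) (γ : Fin 5 → Fin 5 → C(I, ℂ))
    (hs : ∀ a b, a < b → γ a b 0 = p a) (ht : ∀ a b, a < b → γ a b 1 = p b)
    (hd : ∀ a b c d, a < b → c < d → a ≠ c → a ≠ d → b ≠ c → b ≠ d → ∀ s t, γ a b s ≠ γ c d t) :
    False := by
  have hpoint : ∀ x a b, a < b → x ≠ a → x ≠ b → ∀ t, γ a b t ≠ p x := by
    intro x a b hab hxa hxb t
    obtain ⟨y, hyx, hya, hyb⟩ : ∃ y, y ≠ x ∧ y ≠ a ∧ y ≠ b := by decide +revert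
    rcases lt_or_gt_of_ne hyx with h | h
    · rw [← ht y x h]; exact hd _ _ _ _ hab h hya.symm hxa.symm hyb.symm hxb.symm _ _
    · rw [← hs x y h]; exact hd _ _ _ _ hab h hxa.symm hya.symm hxb.symm hyb.symm _ _
  have hinj : ∀ x y, x ≠ y → p y - p x ≠ 0 := by
    intro x y hxy
    obtain ⟨z, hzx, hzy⟩ : ∃ z, z ≠ x ∧ z ≠ y := by decide +revert
    rw [sub_ne_zero]
    rcases lt_or_gt_of_ne hzy with h | h
    · rw [← ht z y h]; exact hpoint x z y h hzx.symm hxy _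
    · rw [← hs y z h]; exact hpoint x y z h hxy hzx.symm _
  -- A logarithm of `p y - p x` is split into a part `m` symmetric in `x, y` and a multiple `ε` of
  -- `πi` recording the sign. In the four-term identity the `m` cancel and an equation between
  -- integers remains.
  set ε : Fin 5 → Fin 5 → ℤ := fun x y => if x < y then 0 else 1 with hε
  obtain ⟨m, hmsymm, hm⟩ : ∃ m : Fin 5 → Fin 5 → ℂ, (∀ x y, m x y = m y x) ∧
      ∀ x y, x ≠ y → Complex.exp (m x y + Real.pi * Complex.I * ε x y) = p y - p x := by
    refine ⟨fun x y => Complex.log (p (max x y) - p (min x y)), fun x y => ?_, fun x y hxy => ?_⟩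
    · simp only [max_comm x y, min_comm x y]
    · rcases lt_or_gt_of_ne hxy with h | h
      · simp [hε, h, h.le, Complex.exp_log (hinj x y hxy)]
      · simp [hε, h.not_gt, h.le, Complex.exp_add, Complex.exp_log (hinj y x hxy.symm)]
  have hn : ∀ x a b, a < b → x ≠ a → x ≠ b → ∃ n : ℤ, ∀ (l : C(I, ℂ)) (c : ℂ),
      (∀ t, Complex.exp (l t) = c * (γ a b t - p x)) → l 1 - l 0 =
        (m x b - m x a) + Real.pi * Complex.I * ((ε x b - ε x a + 2 * n : ℤ) : ℂ) := by
    intro x a b hab hxa hxb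
    obtain ⟨w, hw, hl⟩ := exists_log_variation (γ a b) (p x) (hpoint x a b hab hxa hxb)
    rw [hs _ _ hab, ht _ _ hab, ← hm x a hxa, ← hm x b hxb, ← Complex.exp_add,
      Complex.exp_eq_exp_iff_exists_int] at hw
    obtain ⟨n, hn⟩ := hw
    refine ⟨n, fun l c hlc => ?_⟩
    rw [hl l c hlc]
    push_cast
    linear_combination hn
  choose! n hn using hn
  have key : ∀ a b c d, a < b → c < d → a ≠ c → a ≠ d → b ≠ c → b ≠ d →
      (ε c b - ε c a) - (ε d b - ε d a) + (ε b d - ε b c) - (ε a d - ε a c) +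
        2 * (n c a b - n d a b + n b c d - n a c d) = 0 := by
    intro a b c d hab hcd hac had hbc hbd
    obtain ⟨lc, ld, la, lb, h1, h2, h3, h4, h5⟩ :=
      log_variation_of_disjoint (γ a b) (γ c d) (hd a b c d hab hcd hac had hbc hbd)
    simp only [hs _ _ hab, ht _ _ hab, hs _ _ hcd, ht _ _ hcd] at h1 h2 h3 h4
    rw [hn c a b hab hac.symm hbc.symm lc _ h1, hn d a b hab had.symm hbd.symm ld _ h2,
      hn a c d hcd hac had la _ h3, hn b c d hcd hbc hbd lb _ h4] at h5
    have hpi : (Real.pi : ℂ) * Complex.I ≠ 0 :=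
      mul_ne_zero (by exact_mod_cast Real.pi_ne_zero) Complex.I_ne_zero
    have : (((ε c b - ε c a) - (ε d b - ε d a) + (ε b d - ε b c) - (ε a d - ε a c) +
        2 * (n c a b - n d a b + n b c d - n a c d) : ℤ) : ℂ) = 0 := by
      apply mul_left_cancel₀ hpi
      push_cast at h5 ⊢
      rw [mul_zero, ← h5, hmsymm c b, hmsymm c a, hmsymm d b, hmsymm d a]
      ring
    exact_mod_cast this
  -- Sum over all 15 pairs of independent edges. Each `n x a b` occurs in two of the equations with
  -- coefficient `±2`, hence contributes a multiple of 4. The `ε` part is `-2` when the pairs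
  -- interlace and 0 otherwise; one pairing of each 4-subset interlaces, so the constants total
  -- `-10`, which is not divisible by 4.
  have e1 := key 0 1 2 3 (by decide) (by decide) (by decide) (by decide) (by decide) (by decide)
  have e2 := key 0 2 1 3 (by decide) (by decide) (by decide) (by decide) (by decide) (by decide)
  have e3 := key 0 3 1 2 (by decide) (by decide) (by decide) (by decide) (by decide) (by decide)
  have e4 := key 0 1 2 4 (by decide) (by decide) (by decide) (by decide) (by decide) (by decide)
  have e5 := key 0 2 1 4 (by decide) (by decide) (by decide) (by decide) (by decide) (by decide)
  have e6 := key 0 4 1 2 (by decide) (by decide) (by decide) (by decide) (by decide) (by decide)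
  have e7 := key 0 1 3 4 (by decide) (by decide) (by decide) (by decide) (by decide) (by decide)
  have e8 := key 0 3 1 4 (by decide) (by decide) (by decide) (by decide) (by decide) (by decide)
  have e9 := key 0 4 1 3 (by decide) (by decide) (by decide) (by decide) (by decide) (by decide)
  have e10 := key 0 2 3 4 (by decide) (by decide) (by decide) (by decide) (by decide) (by decide)
  have e11 := key 0 3 2 4 (by decide) (by decide) (by decide) (by decide) (by decide) (by decide)
  have e12 := key 0 4 2 3 (by decide) (by decide) (by decide) (by decide) (by decide) (by decide)
  have e13 := key 1 2 3 4 (by decide) (by decide) (by decide) (by decide) (by decide) (by decide)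
  have e14 := key 1 3 2 4 (by decide) (by decide) (by decide) (by decide) (by decide) (by decide)
  have e15 := key 1 4 2 3 (by decide) (by decide) (by decide) (by decide) (by decide) (by decide)
  simp [hε] at e1 e2 e3 e4 e5 e6 e7 e8 e9 e10 e11 e12 e13 e14 e15
  clear_value ε
  omega

/-! ### Complete minors in dense graphs -/

namespace SimpleGraph

variable {V : Type*}

/-- The graph obtained by contracting `b` into `a`; the vertex `b` remains as an isolated vertex. -/
def contract (G : SimpleGraph V) (a b : V) : SimpleGraph V where
  Adj x y := x ≠ y ∧ x ≠ b ∧ y ≠ b ∧ (G.Adj x y ∨ (x = a ∧ G.Adj b y) ∨ (y = a ∧ G.Adj b x))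
  symm := ⟨fun x y h => ⟨h.1.symm, h.2.2.1, h.2.1, by
    rcases h.2.2.2 with h | h | h
    · exact .inl h.symm
    · exact .inr (.inr h)
    · exact .inr (.inl h)⟩⟩
  loopless := ⟨fun x h => h.1 rfl⟩

theorem contract_adj {G : SimpleGraph V} {a b x y : V} : (G.contract a b).Adj x y ↔
    x ≠ y ∧ x ≠ b ∧ y ≠ b ∧ (G.Adj x y ∨ (x = a ∧ G.Adj b y) ∨ (y = a ∧ G.Adj b x)) := Iff.rfl

theorem support_contract_subset {G : SimpleGraph V} {a b : V} (hab : G.Adj a b) :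
    (G.contract a b).support ⊆ G.support \ {b} := by
  rintro x ⟨y, hxy, hxb, hyb, h | h | h⟩
  · exact ⟨⟨y, h⟩, hxb⟩
  · exact ⟨⟨b, h.1 ▸ hab⟩, hxb⟩
  · exact ⟨⟨b, h.2.symm⟩, hxb⟩

/-- Moving `b` to `a` destroys the edge `ab` and merges `au` with `bu` for each common neighbour
`u`; no other edges are lost or identified. -/
theorem ncard_edgeSet_le_contract [Finite V] {G : SimpleGraph V} {a b : V} (hab : G.Adj a b) :
    G.edgeSet.ncard ≤
      (G.contract a b).edgeSet.ncard + 1 + (G.neighborSet a ∩ G.neighborSet b).ncard := by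
  classical
  set T : Set (Sym2 V) := (fun u => s(b, u)) '' (G.neighborSet a ∩ G.neighborSet b) with hT
  have hsub : G.edgeSet ⊆ ((G.edgeSet \ ({s(a, b)} ∪ T)) ∪ {s(a, b)}) ∪ T := by
    intro e he
    by_cases h1 : e ∈ T
    · exact .inr h1
    by_cases h2 : e = s(a, b)
    · exact .inl (.inr h2)
    · exact .inl (.inl ⟨he, by simp [h1, h2]⟩)
  have hinj : (G.edgeSet \ ({s(a, b)} ∪ T)).ncard ≤ (G.contract a b).edgeSet.ncard := by
    have hne := hab.ne
    refine Set.ncard_le_ncard_of_injOn (Sym2.map fun v => if v = b then a else v) ?_ ?_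
      (Set.toFinite _)
    · intro e
      induction e with | _ x y
      rintro ⟨he, hn⟩
      simp only [hT, Set.mem_union, Set.mem_singleton_iff, Set.mem_image, Set.mem_inter_iff,
        mem_neighborSet, not_or, mem_edgeSet, Sym2.eq_iff, not_exists] at he hn
      simp only [Sym2.map_mk, mem_edgeSet, contract_adj]
      have := he.ne
      have := he.symm
      grind
    · intro e he e' he'
      induction e with | _ x y
      induction e' with | _ z w
      obtain ⟨he, hn⟩ := he
      obtain ⟨he', hn'⟩ := he'
      simp only [hT, Set.mem_union, Set.mem_singleton_iff, Set.mem_image, Set.mem_inter_iff,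
        mem_neighborSet, not_or, mem_edgeSet, Sym2.eq_iff, not_exists] at he hn he' hn'
      simp only [Sym2.map_mk, Sym2.eq_iff]
      have := he.ne
      have := he.symm
      have := he'.ne
      have := he'.symm
      grind
  have h1 := Set.ncard_le_ncard hsub (Set.toFinite _)
  have h2 := Set.ncard_union_le ((G.edgeSet \ ({s(a, b)} ∪ T)) ∪ {s(a, b)}) T
  have h3 := Set.ncard_union_le (G.edgeSet \ ({s(a, b)} ∪ T)) {s(a, b)}
  have h4 : T.ncard ≤ (G.neighborSet a ∩ G.neighborSet b).ncard :=
    Set.ncard_image_le (Set.toFinite _)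
  rw [Set.ncard_singleton] at h3
  omega

/-- A class of graphs on a fixed vertex set which is closed under subgraphs and contractions. -/
structure MinorClosed (C : SimpleGraph V → Prop) : Prop where
  mono : ∀ {G H}, H ≤ G → C G → C H
  contract : ∀ {G a b}, G.Adj a b → C G → C (G.contract a b)

/-- The graph obtained by joining `v` to all non-isolated vertices. -/
def cone (G : SimpleGraph V) (v : V) : SimpleGraph V where
  Adj x y := G.Adj x y ∨ (x ≠ y ∧ x = v ∧ y ∈ G.support) ∨ (x ≠ y ∧ y = v ∧ x ∈ G.support)
  symm := ⟨fun x y h => by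
    rcases h with h | h | h
    · exact .inl h.symm
    · exact .inr (.inr ⟨h.1.symm, h.2⟩)
    · exact .inr (.inl ⟨h.1.symm, h.2⟩)⟩
  loopless := ⟨fun x h => by simp at h⟩

theorem cone_adj {G : SimpleGraph V} {v x y : V} : (G.cone v).Adj x y ↔
    G.Adj x y ∨ (x ≠ y ∧ x = v ∧ y ∈ G.support) ∨ (x ≠ y ∧ y = v ∧ x ∈ G.support) := Iff.rfl

/-- The cone over a contraction is a subgraph of the contraction of the cone. This lets the
induction for cliques pass to a neighbourhood and add the apex back afterwards. -/
theorem MinorClosed.cone {C : SimpleGraph V → Prop} (hC : MinorClosed C) (v : V) :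
    MinorClosed fun H : SimpleGraph V => v ∉ H.support ∧ C (H.cone v) where
  mono {G H} hHG h := by
    have hs : H.support ⊆ G.support := support_mono hHG
    refine ⟨fun hv => h.1 (hs hv), hC.mono ?_ h.2⟩
    rintro x y (hxy | hxy | hxy)
    · exact .inl (hHG hxy)
    · exact .inr (.inl ⟨hxy.1, hxy.2.1, hs hxy.2.2⟩)
    · exact .inr (.inr ⟨hxy.1, hxy.2.1, hs hxy.2.2⟩)
  contract {G a b} hab h := by
    have hs := support_contract_subset hab
    have hvb : v ≠ b := fun hv => h.1 (hv ▸ ⟨a, hab.symm⟩)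
    refine ⟨fun hv => h.1 (hs hv).1, hC.mono ?_
      (hC.contract (show (G.cone v).Adj a b from Or.inl hab) h.2)⟩
    rintro x y (⟨h1, h2, h3, hxy⟩ | hxy | hxy)
    · refine ⟨h1, h2, h3, ?_⟩
      simp only [cone_adj]
      tauto
    · obtain ⟨h1, rfl, h2⟩ := hxy
      exact ⟨h1, hvb, (hs h2).2, .inl (.inr (.inl ⟨h1, rfl, (hs h2).1⟩))⟩
    · obtain ⟨h1, rfl, h2⟩ := hxy
      exact ⟨h1, (hs h2).2, hvb, .inl (.inr (.inr ⟨h1, rfl, (hs h2).1⟩))⟩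

/-- A graph whose edges all lie in many triangles has dense neighbourhoods. -/
theorem lt_ncard_edgeSet_neighborhood [Finite V] {G : SimpleGraph V} {c : ℕ}
    (hG : ∀ a b, G.Adj a b → 2 * c + 1 ≤ (G.neighborSet a ∩ G.neighborSet b).ncard)
    {v u : V} (hvu : G.Adj v u) (H : SimpleGraph V)
    (hH : ∀ x y, H.Adj x y ↔ G.Adj x y ∧ G.Adj v x ∧ G.Adj v y) :
    c * H.support.ncard < H.edgeSet.ncard := by
  classical
  have := Fintype.ofFinite V
  have hsupp : H.support ⊆ G.neighborSet v := fun x ⟨y, hxy⟩ => ((hH x y).1 hxy).2.1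
  have h1 : H.support.ncard ≤ (G.neighborSet v).ncard := Set.ncard_le_ncard hsupp
  have h2 : 0 < (G.neighborSet v).ncard := (Set.ncard_pos).2 ⟨u, hvu⟩
  have hdeg : ∀ x ∈ (G.neighborSet v).toFinset, 2 * c + 1 ≤ H.degree x := by
    intro x hx
    rw [Set.mem_toFinset] at hx
    refine (hG v x hx).trans ?_
    rw [← card_neighborSet_eq_degree, ← Nat.card_coe_set_eq, Nat.card_eq_fintype_card]
    refine Set.card_le_card fun y hy => ?_
    exact (hH x y).2 ⟨hy.2, hx, hy.1⟩
  -- Handshake: the odd bound `2 * c + 1` leaves a surplus of one per neighbour, which makes the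
  -- final inequality strict.
  have h3 : (G.neighborSet v).ncard * (2 * c + 1) ≤ 2 * H.edgeSet.ncard := by
    have e : H.edgeSet.ncard = H.edgeFinset.card := by
      rw [← coe_edgeFinset, Set.ncard_coe_finset]
    rw [e, ← sum_degrees_eq_twice_card_edges, Set.ncard_eq_toFinset_card']
    calc _ = ∑ x ∈ (G.neighborSet v).toFinset, (2 * c + 1) := by simp
      _ ≤ ∑ x ∈ (G.neighborSet v).toFinset, H.degree x := Finset.sum_le_sum hdeg
      _ ≤ _ := Finset.sum_le_sum_of_subset (Finset.subset_univ _)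
  nlinarith

/-- A dense graph has a large complete minor. -/
theorem MinorClosed.exists_clique [Finite V] (t : ℕ) : ∀ (C : SimpleGraph V → Prop),
    MinorClosed C → ∀ G, C G → (2 ^ t - 1) * G.support.ncard < G.edgeSet.ncard →
      ∃ K, C K ∧ ∃ f : Fin (t + 2) → V, ∀ i j, i ≠ j → K.Adj (f i) (f j) := by
  induction t with
  | zero =>
    intro C _ G hG h
    obtain ⟨e, he⟩ : G.edgeSet.Nonempty := by
      rw [← Set.ncard_pos]; omega
    induction e with | _ a b
    refine ⟨G, hG, ![a, b], fun i j hij => ?_⟩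
    fin_cases i <;> fin_cases j
    · exact absurd rfl hij
    · exact he
    · exact (show G.Adj a b from he).symm
    · exact absurd rfl hij
  | succ t ih =>
    intro C hC G
    induction hm : G.support.ncard using Nat.strong_induction_on generalizing G with
    | _ m ihm
    subst hm
    intro hG hE
    obtain ⟨c, hc⟩ : ∃ c, 2 ^ t - 1 = c := ⟨_, rfl⟩
    have hc' : 2 ^ (t + 1) - 1 = 2 * c + 1 := by
      have := Nat.one_le_two_pow (n := t)
      rw [pow_succ]; omega
    simp only [hc, hc'] at ih ihm hE ⊢
    by_cases h : ∃ a b, G.Adj a b ∧ (G.neighborSet a ∩ G.neighborSet b).ncard < 2 * c + 1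
    · obtain ⟨a, b, hab, hlt⟩ := h
      have h1 : (G.contract a b).support.ncard + 1 ≤ G.support.ncard := by
        have hb : b ∈ G.support := ⟨a, hab.symm⟩
        rw [← Set.ncard_sdiff_singleton_add_one hb]
        exact Nat.add_le_add_right (Set.ncard_le_ncard (support_contract_subset hab)) 1
      -- At least one non-isolated vertex and at most `2 * c + 1` edges disappear, so the density
      -- hypothesis survives.
      refine ihm _ (by omega) (G.contract a b) rfl (hC.contract hab hG) ?_
      have h2 := ncard_edgeSet_le_contract hab
      have h3 := Nat.mul_le_mul_left (2 * c + 1) h1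
      rw [Nat.mul_add, Nat.mul_one] at h3
      omega
    · push Not at h
      obtain ⟨e, he⟩ : G.edgeSet.Nonempty := by
        rw [← Set.ncard_pos]; omega
      induction e with | _ v u
      let H : SimpleGraph V :=
        { Adj := fun x y => G.Adj x y ∧ G.Adj v x ∧ G.Adj v y
          symm := ⟨fun x y h => ⟨h.1.symm, h.2.2, h.2.1⟩⟩
          loopless := ⟨fun x h => h.1.ne rfl⟩ }
      have hsupp : ∀ x ∈ H.support, G.Adj v x := fun x ⟨y, hxy⟩ => hxy.2.1
      -- Every edge now lies in many triangles, so the neighbourhood `H` of `v` is dense enough for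
      -- a clique minor one vertex smaller, which `v` then completes.
      obtain ⟨K, ⟨hvK, hK⟩, f, hf⟩ := ih _ (hC.cone v) H
        ⟨fun hv => (hsupp v hv).ne rfl, hC.mono (by
          rintro x y (hxy | ⟨-, rfl, hy⟩ | ⟨-, rfl, hx⟩)
          · exact hxy.1
          · exact hsupp y hy
          · exact (hsupp x hx).symm) hG⟩
        (lt_ncard_edgeSet_neighborhood h he H fun _ _ => Iff.rfl)
      have hfs : ∀ i, f i ∈ K.support := fun i => by
        obtain ⟨j, hj⟩ := exists_ne i
        exact ⟨f j, hf i j hj.symm⟩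
      have hne : ∀ i, f i ≠ v := fun i hi => hvK (hi ▸ hfs i)
      refine ⟨K.cone v, hK, Fin.cons v f, fun i j => ?_⟩
      refine Fin.cases ?_ (fun i => ?_) i <;> refine Fin.cases ?_ (fun j => ?_) j
      · intro h; exact absurd rfl h
      · intro _; exact .inr (.inl ⟨(hne j).symm, rfl, hfs j⟩)
      · intro _; exact .inr (.inr ⟨hne i, rfl, hfs i⟩)
      · intro hij; exact .inl (hf i j fun h => hij (h ▸ rfl))

/-! ### Weak drawings and the linear edge bound -/

/-- A drawing in the plane such that the arcs of vertex-disjoint edges are disjoint; there is no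
condition on edges with a common endpoint. -/
def HasWeakDrawing (G : SimpleGraph V) : Prop :=
  ∃ (p : V → ℂ) (D : V → V → Set ℂ), (∀ x y, G.Adj x y → JoinedIn (D x y) (p x) (p y)) ∧
    ∀ x y z w, G.Adj x y → G.Adj z w → x ≠ z → x ≠ w → y ≠ z → y ≠ w → Disjoint (D x y) (D z w)

theorem IsPlanar.hasWeakDrawing {G : SimpleGraph V} (hG : G.IsPlanar) : G.HasWeakDrawing := by
  classical
  obtain ⟨E⟩ := hG
  let φ : ℝ × ℝ → ℂ := Complex.equivRealProdCLM.symm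
  have hφ : Continuous φ := Complex.equivRealProdCLM.symm.continuous
  have hφi : Function.Injective φ := Complex.equivRealProdCLM.symm.injective
  refine ⟨fun v => φ (E.point v),
    fun x y => if h : G.Adj x y then Set.range fun t => φ (E.arc ⟨s(x, y), h⟩ t) else ∅, ?_, ?_⟩
  · intro x y h
    simp only [h, dif_pos]
    have hj : JoinedIn (Set.range fun t => φ (E.arc ⟨s(x, y), h⟩ t))
        (φ (E.arc ⟨s(x, y), h⟩ 0)) (φ (E.arc ⟨s(x, y), h⟩ 1)) :=
      ⟨⟨⟨fun t => φ (E.arc ⟨s(x, y), h⟩ t), hφ.comp (E.arc_continuous _)⟩, rfl, rfl⟩,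
        fun t => ⟨t, rfl⟩⟩
    have he := E.arc_ends ⟨s(x, y), h⟩
    simp only [Sym2.map_mk, Sym2.eq_iff] at he
    rcases he with ⟨h0, h1⟩ | ⟨h0, h1⟩
    · rwa [h0, h1] at hj
    · rw [h0, h1] at hj
      exact hj.symm
  · intro x y z w h h' hxz hxw hyz hyw
    simp only [h, h', dif_pos]
    rw [Set.disjoint_left]
    rintro _ ⟨t, rfl⟩ ⟨t', ht⟩
    obtain ⟨v, hv, hv', -⟩ := E.arc_inter_arc ⟨s(x, y), h⟩ ⟨s(z, w), h'⟩
      (fun heq => by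
        have := congrArg Subtype.val heq
        simp only [Sym2.eq_iff] at this
        tauto) t t' (hφi ht).symm
    simp only [Sym2.mem_iff] at hv hv'
    rcases hv with rfl | rfl <;> tauto

/-- An edge inherited from `b` is drawn along `ab` and then along the old path at `b`. The new paths
may overlap one another, but only when they share the endpoint `a`, which a weak drawing permits. -/
theorem minorClosed_hasWeakDrawing : MinorClosed (HasWeakDrawing (V := V)) where
  mono := by
    rintro G H hHG ⟨p, D, h1, h2⟩
    exact ⟨p, D, fun x y h => h1 x y (hHG h),
      fun x y z w h h' => h2 x y z w (hHG h) (hHG h')⟩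
  contract := by
    classical
    rintro G a b hab ⟨p, D, h1, h2⟩
    refine ⟨p, fun x y => if G.Adj x y then D x y else
      if x = a then D a b ∪ D b y else D b x ∪ D a b, ?_, ?_⟩
    · rintro x y ⟨hxy, hxb, hyb, h⟩
      by_cases hG : G.Adj x y
      · simp only [hG, if_true]; exact h1 x y hG
      · simp only [hG, if_false]
        by_cases hxa : x = a
        · subst hxa
          have hby : G.Adj b y := by tauto
          simp only [if_true]
          exact ((h1 _ _ hab).mono Set.subset_union_left).trans
            ((h1 _ _ hby).mono Set.subset_union_right)
        · obtain ⟨rfl, hbx⟩ : y = a ∧ G.Adj b x := by tauto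
          simp only [hxa, if_false]
          exact ((h1 _ _ hbx).symm.mono Set.subset_union_left).trans
            ((h1 _ _ hab).symm.mono Set.subset_union_right)
    -- Each point of a new path lies on an old one whose ends are among `x`, `y`, or `b` if `a` is
    -- an end. At most one of two independent edges has the end `a`, so the old edges are
    -- independent too.
    · have key : ∀ x y, (G.contract a b).Adj x y → ∀ q ∈ (if G.Adj x y then D x y else
          if x = a then D a b ∪ D b y else D b x ∪ D a b), ∃ u v, G.Adj u v ∧ q ∈ D u v ∧
          (u = x ∨ u = y ∨ u = b ∧ (a = x ∨ a = y)) ∧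
          (v = x ∨ v = y ∨ v = b ∧ (a = x ∨ a = y)) := by
        rintro x y ⟨hxy, hxb, hyb, h⟩ q hq
        split_ifs at hq with h3 h4
        · exact ⟨x, y, h3, hq, by tauto, by tauto⟩
        · have hby : G.Adj b y := by grind
          rcases hq with hq | hq
          · exact ⟨a, b, hab, hq, by tauto, by tauto⟩
          · exact ⟨b, y, hby, hq, by tauto, by tauto⟩
        · have hby : y = a ∧ G.Adj b x := by tauto
          rcases hq with hq | hq
          · exact ⟨b, x, hby.2, hq, by tauto, by tauto⟩
          · exact ⟨a, b, hab, hq, by tauto, by tauto⟩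
      intro x y z w h h' hxz hxw hyz hyw
      rw [Set.disjoint_left]
      intro q hq hq'
      obtain ⟨u, v, huv, hquv, hu, hv⟩ := key x y h q hq
      obtain ⟨u', v', huv', hquv', hu', hv'⟩ := key z w h' q hq'
      obtain ⟨-, hxb, hyb, -⟩ := h
      obtain ⟨-, hzb, hwb, -⟩ := h'
      refine Set.disjoint_left.1 (h2 u v u' v' huv huv' ?_ ?_ ?_ ?_) hquv hquv' <;> grind

theorem HasWeakDrawing.not_clique_five {G : SimpleGraph V} (hG : G.HasWeakDrawing)
    (f : Fin 5 → V) (hf : ∀ i j, i ≠ j → G.Adj (f i) (f j)) : False := by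
  obtain ⟨p, D, h1, h2⟩ := hG
  have hne : ∀ i j, i ≠ j → f i ≠ f j := fun i j hij => (hf i j hij).ne
  have hj : ∀ i j, i < j → ∃ γ : C(unitInterval, ℂ), γ 0 = p (f i) ∧ γ 1 = p (f j) ∧
      ∀ t, γ t ∈ D (f i) (f j) := by
    intro i j hij
    obtain ⟨γ, hγ⟩ := h1 _ _ (hf i j hij.ne)
    exact ⟨γ.toContinuousMap, γ.source, γ.target, hγ⟩
  choose! γ h0 h1' hD using hj
  refine not_exists_drawing_five (fun i => p (f i)) γ h0 h1' ?_
  intro a b c d hab hcd hac had hbc hbd s t hst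
  refine Set.disjoint_left.1 (h2 _ _ _ _ (hf a b hab.ne) (hf c d hcd.ne) (hne _ _ hac)
    (hne _ _ had) (hne _ _ hbc) (hne _ _ hbd)) (hD a b hab s) ?_
  rw [hst]
  exact hD c d hcd t

/-- The constant is `2 ^ 3 - 1`, the density that forces a clique minor on `3 + 2` vertices. -/
theorem HasWeakDrawing.ncard_edgeSet_le [Finite V] {G : SimpleGraph V} (hG : G.HasWeakDrawing) :
    G.edgeSet.ncard ≤ 7 * G.support.ncard := by
  by_contra! h
  obtain ⟨K, hK, f, hf⟩ :=
    minorClosed_hasWeakDrawing.exists_clique 3 _ G hG (by norm_num; exact h)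
  exact hK.not_clique_five f hf


/-! ### Degeneracy and the upper bound -/

theorem HasWeakDrawing.exists_card_neighbors_le [Fintype V] {G : SimpleGraph V}
    (hG : G.HasWeakDrawing) (S : Finset V) (hS : S.Nonempty) :
    ∃ v ∈ S, {u | u ∈ S ∧ G.Adj v u}.ncard ≤ 14 := by
  classical
  by_contra! h
  let H : SimpleGraph V :=
    { Adj := fun x y => G.Adj x y ∧ x ∈ S ∧ y ∈ S
      symm := ⟨fun x y h => ⟨h.1.symm, h.2.2, h.2.1⟩⟩
      loopless := ⟨fun x h => h.1.ne rfl⟩ }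
  have h1 : H.edgeSet.ncard ≤ 7 * H.support.ncard :=
    (minorClosed_hasWeakDrawing.mono (fun x y (h : H.Adj x y) => h.1) hG).ncard_edgeSet_le
  have h2 : H.support.ncard ≤ S.card := by
    rw [← Set.ncard_coe_finset]
    exact Set.ncard_le_ncard fun x ⟨y, hxy⟩ => hxy.2.1
  have hdeg : ∀ v ∈ S, 15 ≤ H.degree v := by
    intro v hv
    refine (Nat.succ_le_of_lt (h v hv)).trans ?_
    rw [← card_neighborSet_eq_degree, ← Nat.card_eq_fintype_card, Nat.card_coe_set_eq]
    exact Set.ncard_le_ncard fun u hu => ⟨hu.2, hv, hu.1⟩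
  have h3 : S.card * 15 ≤ 2 * H.edgeSet.ncard := by
    have e : H.edgeSet.ncard = H.edgeFinset.card := by
      rw [← coe_edgeFinset, Set.ncard_coe_finset]
    rw [e, ← sum_degrees_eq_twice_card_edges]
    calc _ = ∑ x ∈ S, 15 := by simp
      _ ≤ ∑ x ∈ S, H.degree x := Finset.sum_le_sum hdeg
      _ ≤ _ := Finset.sum_le_sum_of_subset (Finset.subset_univ _)
  have := hS.card_pos
  omega

/-- A degenerate graph has a vertex ordering in which every vertex has few later neighbours. -/
theorem exists_degeneracy_order [Fintype V] {G : SimpleGraph V} {d : ℕ}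
    (hG : ∀ S : Finset V, S.Nonempty → ∃ v ∈ S, {u | u ∈ S ∧ G.Adj v u}.ncard ≤ d) :
    ∃ r : V → ℕ, Function.Injective r ∧ ∀ v, {u | G.Adj v u ∧ r v < r u}.ncard ≤ d := by
  classical
  suffices h : ∀ S : Finset V, ∃ r : V → ℕ, Set.InjOn r S ∧
      ∀ v ∈ S, {u | u ∈ S ∧ G.Adj v u ∧ r v < r u}.ncard ≤ d by
    obtain ⟨r, hr, h⟩ := h Finset.univ
    exact ⟨r, by simpa using hr, by simpa using h⟩
  intro S
  induction S using Finset.strongInduction with | _ S ih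
  rcases S.eq_empty_or_nonempty with rfl | hS
  · exact ⟨fun _ => 0, by simp, by simp⟩
  obtain ⟨v, hv, hd⟩ := hG S hS
  obtain ⟨r, hr, h⟩ := ih (S.erase v) (Finset.erase_ssubset hv)
  -- The vertex of small degree comes first, so it has no effect on the later neighbours of the
  -- others.
  refine ⟨fun u => if u = v then 0 else r u + 1, ?_, ?_⟩
  · intro x hx y hy hxy
    by_cases hxv : x = v <;> by_cases hyv : y = v
    · rw [hxv, hyv]
    · simp [hxv, hyv] at hxy
    · simp [hxv, hyv] at hxy
    · simp only [hxv, hyv, if_false, add_left_inj] at hxy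
      exact hr (by simpa [hxv] using hx) (by simpa [hyv] using hy) hxy
  · intro w hw
    by_cases hwv : w = v
    · subst hwv
      refine (Set.ncard_le_ncard ?_ (Set.toFinite _)).trans hd
      exact fun u hu => ⟨hu.1, hu.2.1⟩
    · refine (Set.ncard_le_ncard ?_ (Set.toFinite _)).trans (h w (by simp [hwv, hw]))
      rintro u ⟨hu, hwu, hlt⟩
      by_cases huv : u = v
      · simp [huv] at hlt
      · simp only [huv, hwv, if_false, add_lt_add_iff_right] at hlt
        exact ⟨by simp [huv, hu], hwu, hlt⟩

/-- In a graph with a degeneracy ordering, a copy of `H` is determined up to a bounded number of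
choices by the position of its first vertices, which form an independent set. -/
theorem labelledCopyCount_le [Fintype V] [Nonempty V] {W : Type*} [Fintype W]
    {G : SimpleGraph V} {H : SimpleGraph W} {d m : ℕ} (hd : 0 < d) {r : V → ℕ}
    (hr : Function.Injective r) (hout : ∀ v, {u | G.Adj v u ∧ r v < r u}.ncard ≤ d)
    (hm : ∀ S : Finset W, (∀ i ∈ S, ∀ j ∈ S, ¬ H.Adj i j) → S.card ≤ m) :
    G.labelledCopyCount H ≤
      2 ^ Fintype.card W * (Fintype.card W * d) ^ Fintype.card W * Fintype.card V ^ m := by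
  classical
  have hlabel : ∀ v, ∃ e : V → Fin d, Set.InjOn e {u | G.Adj v u ∧ r v < r u} := by
    intro v
    have hcard : Fintype.card {u | G.Adj v u ∧ r v < r u} ≤ Fintype.card (Fin d) := by
      rw [← Nat.card_eq_fintype_card, Nat.card_coe_set_eq, Fintype.card_fin]
      exact hout v
    obtain ⟨φ⟩ := Function.Embedding.nonempty_of_card_le hcard
    refine ⟨fun u => if h : u ∈ {u | G.Adj v u ∧ r v < r u} then φ ⟨u, h⟩ else ⟨0, hd⟩, ?_⟩
    intro x hx y hy hxy
    simp only [hx, hy, dif_pos] at hxy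
    simpa using φ.injective hxy
  choose e he using hlabel
  -- The local minima of the order along the copy; adjacent vertices cannot both be minimal.
  let src : Copy H G → Finset W := fun f =>
    Finset.univ.filter fun i => ¬ ∃ j, H.Adj i j ∧ r (f j) < r (f i)
  have hpred : ∀ (f : Copy H G) (i : W), ∃ j, i ∉ src f → H.Adj i j ∧ r (f j) < r (f i) := by
    intro f i
    by_cases h : ∃ j, H.Adj i j ∧ r (f j) < r (f i)
    · exact ⟨h.choose, fun _ => h.choose_spec⟩
    -- A local minimum has no predecessor; `i` is a dummy value.
    · exact ⟨i, fun hi => absurd (by simpa [src] using h) hi⟩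
  choose pred hpred using hpred
  have hsrc : ∀ f, (src f).card ≤ m := by
    refine fun f => hm _ fun i hi j hj hij => ?_
    simp only [src, Finset.mem_filter, Finset.mem_univ, true_and, not_exists, not_and,
      not_lt] at hi hj
    exact hij.ne (f.injective (hr (le_antisymm (hi j hij) (hj i hij.symm))))
  have hfib : ∀ S : Finset W, S ∈ Finset.univ → (Finset.univ.filter fun f => src f = S).card ≤
      (Fintype.card W * d) ^ Fintype.card W * Fintype.card V ^ m := by
    intro S _
    by_cases hS : S.card ≤ m
    swap
    · rw [Finset.filter_false_of_mem fun f _ (hf : src f = S) => hS (hf ▸ hsrc f)]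
      simp
    have hcard : Fintype.card ((W → W × Fin d) × (S → V)) =
        (Fintype.card W * d) ^ Fintype.card W * Fintype.card V ^ S.card := by simp
    refine le_trans ?_ (Nat.mul_le_mul_left _ (Nat.pow_le_pow_right Fintype.card_pos hS))
    rw [← hcard, ← Finset.card_univ]
    -- Encode a copy by a predecessor of each vertex, the label of the vertex among the later
    -- neighbours of that predecessor, and the images of the local minima.
    refine Finset.card_le_card_of_injOn
      (fun f => ((fun i => (pred f i, e (f (pred f i)) (f i))), fun i => f i)) (by simp) ?_
    intro f hf g hg hfg
    simp only [Finset.coe_filter, Finset.mem_univ, true_and, Set.mem_ofPred_eq] at hf hg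
    simp only [Prod.mk.injEq, funext_iff] at hfg
    obtain ⟨h1, h2⟩ := hfg
    suffices h : ∀ N i, r (f i) = N → f i = g i from Copy.ext fun i => h _ i rfl
    -- Decode in increasing rank: the image of the predecessor is already known, and the label then
    -- singles out the image of `i`.
    intro N
    induction N using Nat.strong_induction_on with | _ N ih
    rintro i rfl
    by_cases hi : i ∈ S
    · exact h2 ⟨i, hi⟩
    · obtain ⟨ha, hlt⟩ := hpred f i (hf ▸ hi)
      obtain ⟨ha', hlt'⟩ := hpred g i (hg ▸ hi)
      have hfg := ih _ hlt _ rfl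
      rw [← (h1 i).1, ← hfg] at hlt'
      rw [← (h1 i).1] at ha'
      have h3 := (h1 i).2
      rw [← (h1 i).1, ← hfg] at h3
      refine he _ ⟨f.toHom.map_adj ha.symm, hlt⟩ ⟨?_, hlt'⟩ h3
      change G.Adj (f (pred f i)) (g i)
      rw [hfg]
      exact g.toHom.map_adj ha'.symm
  have htot : G.labelledCopyCount H = (Finset.univ : Finset (Copy H G)).card := by
    rw [labelledCopyCount, Finset.card_univ]
  rw [htot, Finset.card_eq_sum_card_fiberwise (f := src) (t := Finset.univ) (by simp)]
  refine (Finset.sum_le_card_nsmul _ _ _ hfib).trans ?_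
  simp [mul_assoc]

/-- An independent set is disjoint from its rotation by one, and both have the same size. -/
theorem card_le_of_cycleGraph_independent {k : ℕ} (hk : 2 ≤ k) (S : Finset (Fin k))
    (hS : ∀ i ∈ S, ∀ j ∈ S, ¬ (cycleGraph k).Adj i j) : S.card ≤ k / 2 := by
  obtain ⟨k, rfl⟩ := Nat.exists_eq_add_of_le' hk
  have h1 : (S.map (addRightEmbedding 1)).card = S.card := Finset.card_map _
  have h2 : Disjoint S (S.map (addRightEmbedding 1)) := by
    rw [Finset.disjoint_left]
    intro i hi hi'
    obtain ⟨j, hj, rfl⟩ := Finset.mem_map.1 hi'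
    exact hS j hj _ hi (cycleGraph_adj.2 (.inr (by simp)))
  have h3 := Finset.card_le_univ (S ∪ S.map (addRightEmbedding 1))
  rw [Finset.card_union_of_disjoint h2, h1, Fintype.card_fin] at h3
  omega

theorem planarMaxCopies_cycleGraph_le {k n : ℕ} (hk : 2 ≤ k) (hn : 0 < n) :
    planarMaxCopies n (cycleGraph k) ≤ 2 ^ k * (k * 14) ^ k * n ^ (k / 2) := by
  classical
  have : Nonempty (Fin n) := ⟨⟨0, hn⟩⟩
  refine Finset.sup_le fun G hG => ?_
  have hG := (Finset.mem_filter.1 hG).2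
  obtain ⟨r, hr, hout⟩ := exists_degeneracy_order hG.hasWeakDrawing.exists_card_neighbors_le
  have := labelledCopyCount_le (by norm_num) hr hout (card_le_of_cycleGraph_independent hk)
  simp only [Fintype.card_fin] at this
  exact copyCount_le_labelledCopyCount.trans this

/-! ### Tools for the lower bound -/

variable {V' W : Type*}

/-- Distinct vertex sets force distinct subgraphs, so automorphisms of `H` need not be considered.
-/
theorem card_le_copyCount [Fintype V] {ι : Type*} [Fintype ι] {G : SimpleGraph V}
    {H : SimpleGraph W} [Finite W] (F : ι → Copy H G)
    (hF : Function.Injective fun i => Set.range (F i)) : Fintype.card ι ≤ G.copyCount H := by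
  classical
  have := Fintype.ofFinite W
  rw [copyCount_eq_card_image_copyToSubgraph, ← Finset.card_univ]
  refine Finset.card_le_card_of_injOn (fun i => (F i).toSubgraph)
    (fun i _ => Finset.mem_coe.2 (Finset.mem_image_of_mem _ (Finset.mem_univ _))) ?_
  intro i _ j _ hij
  refine hF ?_
  simpa using congrArg Subgraph.verts hij

theorem IsPlanar.of_injective {G : SimpleGraph V} {G' : SimpleGraph V'} (hG' : G'.IsPlanar)
    (f : G →g G') (hf : Function.Injective f) : G.IsPlanar := by
  obtain ⟨E⟩ := hG'
  refine ⟨⟨fun v => E.point (f v), fun e => E.arc (f.mapEdgeSet e), E.point_injective.comp hf,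
    fun e => E.arc_continuous _, fun e => E.arc_injective _, fun e => ?_, fun e t w h => ?_,
    fun e e' hne t t' h => ?_⟩⟩
  · rw [E.arc_ends]
    simp [Hom.mapEdgeSet, Sym2.map_map]
  · have := E.vertex_on_arc _ _ _ h
    simp only [Hom.mapEdgeSet, Sym2.mem_map] at this
    obtain ⟨v, hv, hvw⟩ := this
    exact hf hvw ▸ hv
  · obtain ⟨w, hw, hw', hpt⟩ :=
      E.arc_inter_arc _ _ (fun h => hne (Hom.mapEdgeSet.injective f hf h)) t t' h
    simp only [Hom.mapEdgeSet, Sym2.mem_map] at hw hw'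
    obtain ⟨v, hv, rfl⟩ := hw
    obtain ⟨v', hv', hvv⟩ := hw'
    exact ⟨v, hv, hf hvv ▸ hv', hpt⟩

/-- A drawing in which every edge is the graph of a function over an interval. -/
theorem isPlanar_of_profiles {G : SimpleGraph V} (X Y : V → ℝ)
    (hXY : ∀ v w, X v = X w → Y v = Y w → v = w) (F : V → V → ℝ → ℝ)
    (hcont : ∀ u v, Continuous (F u v)) (hne : ∀ u v, G.Adj u v → X u ≠ X v)
    (hends : ∀ u v, G.Adj u v → X u < X v → F u v (X u) = Y u ∧ F u v (X v) = Y v)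
    (hvert : ∀ u v w, G.Adj u v → X u < X v → X u ≤ X w → X w ≤ X v → F u v (X w) = Y w →
      X w = X u ∨ X w = X v)
    (hcross : ∀ u v u' v', G.Adj u v → X u < X v → G.Adj u' v' → X u' < X v' → ∀ x,
      X u ≤ x → x ≤ X v → X u' ≤ x → x ≤ X v' → F u v x = F u' v' x →
      (u = u' ∧ v = v') ∨ ((x = X u ∨ x = X v) ∧ (x = X u' ∨ x = X v'))) : G.IsPlanar := by
  have hrep : ∀ e : G.edgeSet, ∃ u v, e.1 = s(u, v) ∧ G.Adj u v ∧ X u < X v := by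
    rintro ⟨e, he⟩
    induction e with | _ u v
    rcases lt_or_gt_of_ne (hne u v he) with h | h
    · exact ⟨u, v, rfl, he, h⟩
    · exact ⟨v, u, Sym2.eq_swap, G.adj_symm he, h⟩
  choose a b hab hadj hlt using hrep
  have hx0 : ∀ (e : G.edgeSet) (t : unitInterval),
      X (a e) ≤ X (a e) + t * (X (b e) - X (a e)) := fun e t =>
    le_add_of_nonneg_right (mul_nonneg t.2.1 (sub_nonneg.2 (hlt e).le))
  have hx1 : ∀ (e : G.edgeSet) (t : unitInterval),
      X (a e) + t * (X (b e) - X (a e)) ≤ X (b e) := fun e t => by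
    have := mul_le_of_le_one_left (sub_nonneg.2 (hlt e).le) t.2.2
    linarith
  refine ⟨⟨fun v => (X v, Y v), fun e t => (X (a e) + t * (X (b e) - X (a e)),
    F (a e) (b e) (X (a e) + t * (X (b e) - X (a e)))), ?_, ?_, ?_, ?_, ?_, ?_⟩⟩
  · intro v w h
    simp only [Prod.mk.injEq] at h
    exact hXY v w h.1 h.2
  · intro e
    have := hcont (a e) (b e)
    fun_prop
  · intro e t t' h
    simp only [Prod.mk.injEq, add_right_inj] at h
    exact Subtype.ext (mul_right_cancel₀ (sub_ne_zero.2 (hlt e).ne') h.1)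
  · intro e
    have h := hends _ _ (hadj e) (hlt e)
    simp [hab e, h.1, h.2]
  · intro e t w h
    simp only [Prod.mk.injEq] at h
    obtain ⟨h1, h2⟩ := h
    have h3 := hx0 e t
    have h4 := hx1 e t
    rw [h1] at h2 h3 h4
    have h := hends _ _ (hadj e) (hlt e)
    rw [hab e, Sym2.mem_iff]
    rcases hvert _ _ w (hadj e) (hlt e) h3 h4 h2 with h5 | h5
    · exact .inl (hXY _ _ h5 (by rw [← h2, h5, h.1]))
    · exact .inr (hXY _ _ h5 (by rw [← h2, h5, h.2]))
  · intro e e' hee t t' h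
    simp only [Prod.mk.injEq] at h ⊢
    obtain ⟨h1, h2⟩ := h
    have h3 := hx0 e t
    have h4 := hx1 e t
    have h3' := hx0 e' t'
    have h4' := hx1 e' t'
    rw [← h1] at h2 h3' h4'
    have hE := hends _ _ (hadj e) (hlt e)
    have hE' := hends _ _ (hadj e') (hlt e')
    generalize X (a e) + t * (X (b e) - X (a e)) = x at h2 h3 h4 h3' h4' ⊢
    rcases hcross _ _ _ _ (hadj e) (hlt e) (hadj e') (hlt e') x h3 h4 h3' h4' h2 with h | ⟨h, h'⟩
    · exact absurd (Subtype.ext (by rw [hab, hab e', h.1, h.2])) hee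
    -- The crossing is an end of both arcs; having the same coordinates, the two end vertices
    -- coincide.
    · have hw : ∃ w ∈ e.1, x = X w ∧ F (a e) (b e) x = Y w := by
        rcases h with rfl | rfl
        · exact ⟨a e, by simp [hab e], rfl, hE.1⟩
        · exact ⟨b e, by simp [hab e], rfl, hE.2⟩
      have hw' : ∃ w ∈ e'.1, x = X w ∧ F (a e') (b e') x = Y w := by
        rcases h' with rfl | rfl
        · exact ⟨a e', by simp [hab e'], rfl, hE'.1⟩
        · exact ⟨b e', by simp [hab e'], rfl, hE'.2⟩
      obtain ⟨w, hw, hwx, hwy⟩ := hw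
      obtain ⟨w', hw', hwx', hwy'⟩ := hw'
      obtain rfl : w = w' := hXY _ _ (hwx ▸ hwx') (by rw [← hwy, ← hwy', h2])
      exact ⟨w, hw, hw', hwx, hwy⟩

/-! ### The necklace graph and its drawing -/

namespace Necklace

/-- The arc at level `c`: periodic humps above the axis for `c > 0`, and otherwise a single hump
below the axis. -/
noncomputable def profile (g : ℕ) (c : ℤ) (x : ℝ) : ℝ :=
  if 0 < c then c * ((1 - Real.cos (Real.pi * x)) / 2) else (c - 1 / 2) * (x * (2 * g - x) / g ^ 2)

theorem continuous_profile (g : ℕ) (c : ℤ) : Continuous (profile g c) := by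
  unfold profile
  split_ifs <;> fun_prop

theorem profile_nonneg {g : ℕ} {c : ℤ} (hc : 0 < c) (x : ℝ) : 0 ≤ profile g c x := by
  rw [profile, if_pos hc]
  have := Real.cos_le_one (Real.pi * x)
  have : (0 : ℝ) < c := by exact_mod_cast hc
  exact mul_nonneg this.le (by linarith)

theorem profile_nonpos {g : ℕ} {c : ℤ} (hc : c ≤ 0) {x : ℝ} (h0 : 0 ≤ x) (h1 : x ≤ 2 * g) :
    profile g c x ≤ 0 := by
  rw [profile, if_neg (by omega)]
  have : (c : ℝ) ≤ 0 := by exact_mod_cast hc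
  exact mul_nonpos_of_nonpos_of_nonneg (by linarith)
    (div_nonneg (mul_nonneg h0 (by linarith)) (by positivity))

theorem hump_eq_zero {x : ℝ} (h : (1 - Real.cos (Real.pi * x)) / 2 = 0) : ∃ n : ℤ, x = 2 * n := by
  obtain ⟨n, hn⟩ := (Real.cos_eq_one_iff (Real.pi * x)).1 (by linarith)
  refine ⟨n, mul_left_cancel₀ Real.pi_ne_zero ?_⟩
  rw [← hn]; ring

theorem eq_two_mul_of_profile_eq_zero {g : ℕ} {c : ℤ} (hc : 0 < c) {x : ℝ}
    (h : profile g c x = 0) : ∃ n : ℤ, x = 2 * n := by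
  rw [profile, if_pos hc] at h
  have : (c : ℝ) ≠ 0 := by exact_mod_cast hc.ne'
  exact hump_eq_zero ((mul_eq_zero.1 h).resolve_left this)

theorem hump_below_eq_zero {g : ℕ} (hg : 0 < g) {x : ℝ} (h : x * (2 * g - x) / (g : ℝ) ^ 2 = 0) :
    x = 0 ∨ x = 2 * g := by
  have : (g : ℝ) ^ 2 ≠ 0 := by positivity
  rcases mul_eq_zero.1 ((div_eq_zero_iff.1 h).resolve_right this) with h | h
  · exact .inl h
  · exact .inr (by linarith)

theorem eq_zero_or_of_profile_eq_zero {g : ℕ} (hg : 0 < g) {c : ℤ} (hc : c ≤ 0) {x : ℝ}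
    (h : profile g c x = 0) : x = 0 ∨ x = 2 * g := by
  rw [profile, if_neg (by omega)] at h
  have : (c : ℝ) ≤ 0 := by exact_mod_cast hc
  exact hump_below_eq_zero hg ((mul_eq_zero.1 h).resolve_left (by linarith))

/-- The intervals over which there is an edge at level `c`. -/
def IsSpan (g : ℕ) (c : ℤ) (a b : ℝ) : Prop :=
  (0 < c ∧ ∃ n : ℤ, a = n ∧ b = n + 1 ∧ 0 ≤ n) ∨
    (c < 0 ∧ ((a = 0 ∧ b = g) ∨ (a = g ∧ b = 2 * g))) ∨ (c = 0 ∧ a = 0 ∧ b = 2 * g)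

theorem eq_or_eq_of_mem_unit {n m : ℤ} {x : ℝ} (hx : x = m) (h0 : n ≤ x) (h1 : x ≤ n + 1) :
    x = n ∨ x = n + 1 := by
  subst hx
  have h0 : n ≤ m := by exact_mod_cast h0
  have h1 : m ≤ n + 1 := by exact_mod_cast h1
  rcases h0.eq_or_lt with h | h
  · exact .inl (by rw [h])
  · exact .inr (by rw [show m = n + 1 by omega]; push_cast; rfl)

theorem IsSpan.bounds {g : ℕ} {c : ℤ} {a b : ℝ} (h : IsSpan g c a b) (hc : c ≤ 0) :
    0 ≤ a ∧ b ≤ 2 * g := by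
  have hg : (0 : ℝ) ≤ g := Nat.cast_nonneg g
  rcases h with h | ⟨-, ⟨rfl, rfl⟩ | ⟨rfl, rfl⟩⟩ | ⟨-, rfl, rfl⟩
  · omega
  · constructor <;> linarith
  · constructor <;> linarith
  · constructor <;> linarith

theorem IsSpan.eq_or_eq_of_profile_eq_zero {g : ℕ} (hg : 0 < g) {c : ℤ} {a b x : ℝ}
    (h : IsSpan g c a b) (h0 : a ≤ x) (h1 : x ≤ b) (hx : profile g c x = 0) : x = a ∨ x = b := by
  have hg' : (0 : ℝ) < g := by exact_mod_cast hg
  by_cases hc : 0 < c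
  · obtain ⟨m, hm⟩ := eq_two_mul_of_profile_eq_zero hc hx
    rcases h with ⟨-, n, rfl, rfl, -⟩ | h | h
    · exact eq_or_eq_of_mem_unit (m := 2 * m) (by rw [hm]; push_cast; rfl) h0 h1
    · omega
    · omega
  · have hx' := eq_zero_or_of_profile_eq_zero hg (by omega) hx
    rcases h with h | ⟨-, ⟨rfl, rfl⟩ | ⟨rfl, rfl⟩⟩ | ⟨-, rfl, rfl⟩
    · omega
    · rcases hx' with rfl | rfl
      · exact .inl rfl
      · linarith
    · rcases hx' with rfl | rfl
      · linarith
      · exact .inr rfl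
    · exact hx'

/-- Profiles at different levels on the same side of the axis are different multiples of one hump,
and those on opposite sides have opposite signs. So they meet only on the axis, where a span has at
most its ends. -/
theorem IsSpan.cross {g : ℕ} (hg : 0 < g) {c c' : ℤ} {a b a' b' x : ℝ} (h : IsSpan g c a b)
    (h' : IsSpan g c' a' b') (h0 : a ≤ x) (h1 : x ≤ b) (h0' : a' ≤ x) (h1' : x ≤ b')
    (hx : profile g c x = profile g c' x) :
    (c = c' ∧ a = a' ∧ b = b') ∨ ((x = a ∨ x = b) ∧ (x = a' ∨ x = b')) := by
  have hg' : (0 : ℝ) < g := by exact_mod_cast hg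
  by_cases hcc : c = c'
  · subst hcc
    rcases h with ⟨hc, n, rfl, rfl, -⟩ | ⟨hc, h⟩ | ⟨hc, rfl, rfl⟩
    · rcases h' with ⟨-, m, rfl, rfl, -⟩ | h' | h'
      · rcases lt_trichotomy n m with hnm | rfl | hnm
        · have h2 : (n : ℝ) + 1 ≤ m := by exact_mod_cast hnm
          exact .inr ⟨.inr (by linarith), .inl (by linarith)⟩
        · exact .inl ⟨rfl, rfl, rfl⟩
        · have h2 : (m : ℝ) + 1 ≤ n := by exact_mod_cast hnm
          exact .inr ⟨.inl (by linarith), .inr (by linarith)⟩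
      · omega
      · omega
    · rcases h' with h' | ⟨-, h'⟩ | h'
      · omega
      · rcases h with ⟨rfl, rfl⟩ | ⟨rfl, rfl⟩ <;> rcases h' with ⟨rfl, rfl⟩ | ⟨rfl, rfl⟩
        · exact .inl ⟨rfl, rfl, rfl⟩
        · exact .inr ⟨.inr (by linarith), .inl (by linarith)⟩
        · exact .inr ⟨.inl (by linarith), .inr (by linarith)⟩
        · exact .inl ⟨rfl, rfl, rfl⟩
      · omega
    · rcases h' with h' | h' | ⟨-, rfl, rfl⟩
      · omega
      · omega
      · exact .inl ⟨rfl, rfl, rfl⟩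
  · have hz : profile g c x = 0 := by
      have hne : (c : ℝ) - c' ≠ 0 := sub_ne_zero.2 (by exact_mod_cast hcc)
      by_cases hc : 0 < c <;> by_cases hc' : 0 < c'
      · simp only [profile, hc, hc', if_true] at hx ⊢
        rw [← sub_eq_zero, ← sub_mul] at hx
        rw [(mul_eq_zero.1 hx).resolve_left hne, mul_zero]
      · obtain ⟨h2, h3⟩ := h'.bounds (not_lt.1 hc')
        refine le_antisymm (hx ▸ profile_nonpos (not_lt.1 hc') ?_ ?_) (profile_nonneg hc x) <;>
          linarith
      · obtain ⟨h2, h3⟩ := h.bounds (not_lt.1 hc)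
        refine le_antisymm (profile_nonpos (not_lt.1 hc) ?_ ?_) (hx ▸ profile_nonneg hc' x) <;>
          linarith
      · simp only [profile, hc, hc', if_false] at hx ⊢
        rw [← sub_eq_zero, ← sub_mul, sub_sub_sub_cancel_right] at hx
        rw [(mul_eq_zero.1 hx).resolve_left hne, mul_zero]
    exact .inr ⟨h.eq_or_eq_of_profile_eq_zero hg h0 h1 hz,
      h'.eq_or_eq_of_profile_eq_zero hg h0' h1' (hx ▸ hz)⟩

theorem IsSpan.vertex {g : ℕ} (hg : 0 < g) {c : ℤ} {a b x y : ℝ} (h : IsSpan g c a b)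
    (h0 : a ≤ x) (h1 : x ≤ b) (hx : profile g c x = y)
    (hy : y = 0 ∨ (0 < y ∧ ∃ n : ℤ, x = n) ∨ (y < -1 / 2 ∧ x = g)) : x = a ∨ x = b := by
  have hg' : (0 : ℝ) < g := by exact_mod_cast hg
  rcases hy with hy | ⟨hy, m, hm⟩ | ⟨hy, hm⟩
  · exact h.eq_or_eq_of_profile_eq_zero hg h0 h1 (hx.trans hy)
  · by_cases hc : 0 < c
    · rcases h with ⟨-, n, rfl, rfl, -⟩ | h | h
      · exact eq_or_eq_of_mem_unit hm h0 h1
      · omega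
      · omega
    · obtain ⟨h2, h3⟩ := h.bounds (not_lt.1 hc)
      have := profile_nonpos (g := g) (not_lt.1 hc) (h2.trans h0) (h1.trans h3)
      linarith
  · by_cases hc : 0 < c
    · have := profile_nonneg (g := g) hc x
      linarith
    · rcases h with h | ⟨-, ⟨rfl, rfl⟩ | ⟨rfl, rfl⟩⟩ | ⟨rfl, rfl, rfl⟩
      · omega
      · exact .inr hm
      · exact .inl hm
      -- The level-0 arc has height `-1 / 2` at `g`, strictly above the vertices placed there.
      · simp only [profile, lt_irrefl, if_false, hm] at hx
        have h2 : (g : ℝ) * (2 * g - g) / g ^ 2 = 1 := by field_simp; ring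
        rw [h2] at hx
        norm_num at hx
        linarith

/-- The vertices: hubs, vertices of degree two, and isolated vertices. -/
abbrev Vertex (g t q : ℕ) := Fin (g + 1) ⊕ (Fin (g + 1) × Fin t) ⊕ Fin q

variable {g t q : ℕ}

/-- The abscissa of a vertex. -/
def X : Vertex g t q → ℝ
  | .inl i => 2 * (i : ℕ)
  | .inr (.inl (i, _)) => if (i : ℕ) < g then 2 * (i : ℕ) + 1 else g
  | .inr (.inr i) => -1 - (i : ℕ)

/-- The level of a vertex. -/
def level : Vertex g t q → ℤ
  | .inl _ => 0
  | .inr (.inl (i, j)) => if (i : ℕ) < g then (j : ℕ) + 1 else -((j : ℕ) + 1)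
  | .inr (.inr _) => 0

/-- The ordinate of a vertex. -/
noncomputable def Y : Vertex g t q → ℝ
  | .inl _ => 0
  | .inr (.inl (i, j)) => if (i : ℕ) < g then (j : ℕ) + 1 else -((j : ℕ) + 1) - 1 / 2
  | .inr (.inr _) => 0

/-- Adjacency, directed from hubs. -/
def Rel : Vertex g t q → Vertex g t q → Prop
  | .inl i, .inl j => (i : ℕ) = 0 ∧ (j : ℕ) = g
  | .inl i, .inr (.inl (j, _)) =>
    (i : ℕ) = j ∨ (i : ℕ) = j + 1 ∨ ((j : ℕ) = g ∧ (i : ℕ) = 0)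
  | _, _ => False

/-- The hubs `0, …, g` are arranged in a cycle; any two consecutive ones have `t` common neighbours,
and the first and the last one are adjacent. -/
def graph (g t q : ℕ) : SimpleGraph (Vertex g t q) := SimpleGraph.fromRel Rel

theorem point_injective (v w : Vertex g t q) (hX : X v = X w) (hY : Y v = Y w) : v = w := by
  have key : ∀ n m : ℕ, (2 * (n : ℝ)) = 2 * m → n = m := fun n m h => by
    exact_mod_cast (by linarith : (n : ℝ) = m)
  rcases v with i | ⟨i, j⟩ | i <;> rcases w with i' | ⟨i', j'⟩ | i' <;>
    simp only [X, Y] at hX hY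
  · rw [Fin.ext (key _ _ hX)]
  · split_ifs at hY
    · have : (0 : ℝ) ≤ (j' : ℕ) := Nat.cast_nonneg _
      linarith
    · have : (0 : ℝ) ≤ (j' : ℕ) := Nat.cast_nonneg _
      linarith
  · have : (0 : ℝ) ≤ (i' : ℕ) := Nat.cast_nonneg _
    have : (0 : ℝ) ≤ (i : ℕ) := Nat.cast_nonneg _
    linarith
  · have : (0 : ℝ) ≤ (j : ℕ) := Nat.cast_nonneg _
    split_ifs at hY <;> linarith
  · have : (0 : ℝ) ≤ (j : ℕ) := Nat.cast_nonneg _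
    have : (0 : ℝ) ≤ (j' : ℕ) := Nat.cast_nonneg _
    split_ifs at hX hY with h h'
    · rw [Fin.ext (key _ _ (by linarith : (2 * ((i : ℕ) : ℝ)) = 2 * (i' : ℕ))),
        Fin.ext (key _ _ (by linarith : (2 * ((j : ℕ) : ℝ)) = 2 * (j' : ℕ)))]
    · linarith
    · linarith
    · rw [Fin.ext (key _ _ (by linarith : (2 * ((j : ℕ) : ℝ)) = 2 * (j' : ℕ))),
        show i = i' from Fin.ext (by omega)]
  · have : (0 : ℝ) ≤ (j : ℕ) := Nat.cast_nonneg _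
    split_ifs at hY <;> linarith
  · have : (0 : ℝ) ≤ (i' : ℕ) := Nat.cast_nonneg _
    have : (0 : ℝ) ≤ (i : ℕ) := Nat.cast_nonneg _
    linarith
  · have : (0 : ℝ) ≤ (j' : ℕ) := Nat.cast_nonneg _
    split_ifs at hY <;> linarith
  · rw [Fin.ext (key _ _ (by linarith : (2 * ((i : ℕ) : ℝ)) = 2 * (i' : ℕ)))]

theorem profile_nat {c : ℤ} (hc : 0 < c) (n : ℕ) :
    profile g c (2 * n) = 0 ∧ profile g c (2 * n + 1) = c := by
  have h1 : Real.cos (Real.pi * (2 * n)) = 1 := by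
    rw [show Real.pi * (2 * n) = n * (2 * Real.pi) by ring, Real.cos_nat_mul_two_pi]
  have h2 : Real.cos (Real.pi * (2 * n + 1)) = -1 := by
    rw [show Real.pi * (2 * n + 1) = n * (2 * Real.pi) + Real.pi by ring,
      Real.cos_nat_mul_two_pi_add_pi]
  simp only [profile, hc, if_true, h1, h2]
  constructor <;> ring

theorem profile_below (hg : 0 < g) {c : ℤ} (hc : c ≤ 0) :
    profile g c 0 = 0 ∧ profile g c g = c - 1 / 2 ∧ profile g c (2 * g) = 0 := by
  have hg' : (g : ℝ) ≠ 0 := by exact_mod_cast hg.ne'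
  have h2 : (g : ℝ) * (2 * g - g) / g ^ 2 = 1 := by field_simp; ring
  simp only [profile, hc.not_gt, if_false, h2]
  simp

/-- Hubs have level 0, so the sum of the levels is the level of the other end, or 0 for the edge
joining two hubs. -/
theorem edge_of_rel (hg : 0 < g) {u v : Vertex g t q} (h : Rel u v) :
    profile g (level u + level v) (X u) = Y u ∧ profile g (level u + level v) (X v) = Y v ∧
      (X u < X v → IsSpan g (level u + level v) (X u) (X v)) ∧
      (X v < X u → IsSpan g (level u + level v) (X v) (X u)) ∧ X u ≠ X v := by
  have hg' : (0 : ℝ) < g := by exact_mod_cast hg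
  rcases u with i | ⟨i, j⟩ | i <;> rcases v with i' | ⟨i', j'⟩ | i' <;> simp only [Rel] at h
  · obtain ⟨hi, hi'⟩ := h
    obtain ⟨h1, -, h2⟩ := profile_below hg le_rfl
    simp only [X, Y, level, hi, hi', add_zero, Nat.cast_zero, mul_zero]
    refine ⟨h1, h2, fun _ => .inr (.inr ⟨rfl, rfl, rfl⟩), fun h => ?_, ?_⟩
    · linarith
    · intro h; linarith
  · by_cases hi : (i' : ℕ) < g
    · have hc : (0 : ℤ) < (j' : ℕ) + 1 := by positivity
      obtain ⟨h1, h2⟩ := profile_nat (g := g) hc i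
      obtain ⟨h1', h2'⟩ := profile_nat (g := g) hc i'
      simp only [X, Y, level, hi, if_true, zero_add]
      refine ⟨h1, by rw [h2']; push_cast; rfl, ?_⟩
      rcases h with h | h | h
      · rw [h]
        refine ⟨fun _ => .inl ⟨hc, 2 * (i' : ℕ), by push_cast; rfl, by push_cast; rfl,
          by positivity⟩, fun h => ?_, ?_⟩
        · linarith
        · intro h; linarith
      · rw [h]
        refine ⟨fun h => ?_, fun _ => .inl ⟨hc, 2 * (i' : ℕ) + 1, by push_cast; rfl,
          by push_cast; ring, by positivity⟩, ?_⟩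
        · push_cast at h; linarith
        · push_cast; intro h; linarith
      · omega
    · have hc : -(((j' : ℕ) : ℤ) + 1) < 0 := by
        have : (0 : ℤ) ≤ (j' : ℕ) := by positivity
        linarith
      obtain ⟨h1, h2, h3⟩ := profile_below hg hc.le
      simp only [X, Y, level, hi, if_false, zero_add]
      have hi2 : (i : ℕ) = 0 ∨ (i : ℕ) = g := by omega
      rcases hi2 with h | h
      · simp only [h, Nat.cast_zero, mul_zero]
        refine ⟨h1, by rw [h2]; push_cast; rfl, fun _ => .inr (.inl ⟨hc, .inl ⟨rfl, rfl⟩⟩),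
          fun h => ?_, ?_⟩
        · linarith
        · intro h; linarith
      · simp only [h]
        refine ⟨h3, by rw [h2]; push_cast; rfl, fun h => ?_,
          fun _ => .inr (.inl ⟨hc, .inr ⟨rfl, rfl⟩⟩), ?_⟩
        · linarith
        · intro h; linarith

theorem isPlanar_graph (hg : 0 < g) : (graph g t q).IsPlanar := by
  have hrel : ∀ u v : Vertex g t q, (graph g t q).Adj u v → Rel u v ∨ Rel v u :=
    fun u v h => ((SimpleGraph.fromRel_adj _ _ _).1 h).2
  have hends : ∀ u v : Vertex g t q, (graph g t q).Adj u v → X u < X v →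
      profile g (level u + level v) (X u) = Y u ∧ profile g (level u + level v) (X v) = Y v ∧
        IsSpan g (level u + level v) (X u) (X v) := by
    intro u v h hlt
    rcases hrel u v h with h | h
    · obtain ⟨h1, h2, h3, -⟩ := edge_of_rel hg h
      exact ⟨h1, h2, h3 hlt⟩
    · obtain ⟨h1, h2, -, h3, -⟩ := edge_of_rel hg h
      rw [add_comm]
      exact ⟨h2, h1, h3 hlt⟩
  refine isPlanar_of_profiles X Y point_injective (fun u v => profile g (level u + level v))
    (fun _ _ => continuous_profile _ _) ?_ ?_ ?_ ?_
  · intro u v h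
    rcases hrel u v h with h | h
    · exact (edge_of_rel hg h).2.2.2.2
    · exact (edge_of_rel hg h).2.2.2.2.symm
  · intro u v h hlt
    exact ⟨(hends u v h hlt).1, (hends u v h hlt).2.1⟩
  · intro u v w h hlt h0 h1 hw
    refine (hends u v h hlt).2.2.vertex hg h0 h1 hw ?_
    rcases w with i | ⟨i, j⟩ | i
    · exact .inl rfl
    · have : (0 : ℝ) ≤ (j : ℕ) := Nat.cast_nonneg _
      by_cases hi : (i : ℕ) < g
      · simp only [X, Y, hi, if_true]
        exact .inr (.inl ⟨by linarith, 2 * (i : ℕ) + 1, by push_cast; rfl⟩)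
      · simp only [X, Y, hi, if_false]
        exact .inr (.inr ⟨by linarith, trivial⟩)
    · exact .inl rfl
  · intro u v u' v' h hlt h' hlt' x h0 h1 h0' h1' hx
    obtain ⟨e1, e2, hs⟩ := hends u v h hlt
    obtain ⟨e1', e2', hs'⟩ := hends u' v' h' hlt'
    rcases hs.cross hg hs' h0 h1 h0' h1' hx with ⟨hc, ha, hb⟩ | h
    · exact .inl ⟨point_injective _ _ ha (by rw [← e1, ← e1', hc, ha]),
        point_injective _ _ hb (by rw [← e2, ← e2', hc, hb])⟩
    · exact .inr h

/-! ### Many cycles in the necklace -/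

/-- The `p`-th vertex of a cycle which visits the hubs in order. -/
def cycleVertex {k : ℕ} (hk : (k - 1) / 2 = g) (σ : Fin (k / 2) → Fin t) (p : Fin k) :
    Vertex g t q :=
  if h : (p : ℕ) % 2 = 0 then .inl ⟨p / 2, by omega⟩
  else .inr (.inl (⟨p / 2, by omega⟩, σ ⟨p / 2, by omega⟩))

theorem cycleVertex_injective {k : ℕ} (hk : (k - 1) / 2 = g) (σ : Fin (k / 2) → Fin t) :
    Function.Injective (cycleVertex (q := q) hk σ) := by
  intro p p' h
  unfold cycleVertex at h
  split_ifs at h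
  · simp only [Sum.inl.injEq, Fin.mk.injEq] at h
    exact Fin.ext (by omega)
  · simp only [Sum.inr.injEq, Sum.inl.injEq, Prod.mk.injEq, Fin.mk.injEq] at h
    exact Fin.ext (by omega)

/-- The parity of `k` matters only at the closing step: for odd `k` it is the edge between hubs `g`
and 0, for even `k` it leads from the last group of common neighbours to hub 0. -/
theorem cycleVertex_adj {k : ℕ} (h3 : 3 ≤ k) (hk : (k - 1) / 2 = g) (σ : Fin (k / 2) → Fin t)
    {p p' : Fin k} (hp : (p' : ℕ) = p + 1 ∨ ((p : ℕ) = k - 1 ∧ (p' : ℕ) = 0)) :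
    (graph g t q).Adj (cycleVertex hk σ p) (cycleVertex hk σ p') := by
  refine (SimpleGraph.fromRel_adj _ _ _).2 ⟨fun h => ?_, ?_⟩
  · have := congrArg Fin.val (cycleVertex_injective hk σ h)
    omega
  · unfold cycleVertex
    split_ifs <;> simp only [Rel] <;> omega

/-- The cycle through the common neighbours chosen by `σ`. -/
def cycleCopy {k : ℕ} (h3 : 3 ≤ k) (hk : (k - 1) / 2 = g) (σ : Fin (k / 2) → Fin t) :
    Copy (cycleGraph k) (graph g t q) :=
  ⟨⟨cycleVertex hk σ, by
    intro p p' h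
    rw [cycleGraph_adj'] at h
    rcases h with h | h
    · refine (cycleVertex_adj h3 hk σ ?_).symm
      rw [Fin.val_sub] at h
      by_cases hpp : p'.val ≤ p.val
      · rw [show k - p'.val + p.val = (p.val - p'.val) + k by omega, Nat.add_mod_right,
          Nat.mod_eq_of_lt (by omega)] at h
        omega
      · rw [Nat.mod_eq_of_lt (by omega)] at h
        omega
    · refine cycleVertex_adj h3 hk σ ?_
      rw [Fin.val_sub] at h
      by_cases hpp : p.val ≤ p'.val
      · rw [show k - p.val + p'.val = (p'.val - p.val) + k by omega, Nat.add_mod_right,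
          Nat.mod_eq_of_lt (by omega)] at h
        omega
      · rw [Nat.mod_eq_of_lt (by omega)] at h
        omega⟩, cycleVertex_injective hk σ⟩

/-- The cycle contains exactly one vertex of the `i`-th group for each `i < k / 2`, so its vertex
set reveals `σ i`. -/
theorem range_cycleCopy_injective {k : ℕ} (h3 : 3 ≤ k) (hk : (k - 1) / 2 = g) :
    Function.Injective fun σ : Fin (k / 2) → Fin t =>
      Set.range (cycleCopy (q := q) h3 hk σ) := by
  intro σ τ h
  funext i
  have hi : 2 * (i : ℕ) + 1 < k := by omega
  have h1 : cycleVertex (q := q) hk σ ⟨2 * i + 1, hi⟩ ∈ Set.range (cycleCopy (q := q) h3 hk τ) := by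
    rw [← show _ = Set.range (cycleCopy (q := q) h3 hk τ) from h]
    exact ⟨_, rfl⟩
  obtain ⟨p, hp⟩ := h1
  change cycleVertex hk τ p = _ at hp
  unfold cycleVertex at hp
  have hodd : ¬ (2 * (i : ℕ) + 1) % 2 = 0 := by omega
  have hdiv : (2 * (i : ℕ) + 1) / 2 = i := by omega
  simp only [hodd, dif_neg, not_false_eq_true, hdiv] at hp
  split_ifs at hp with hp2
  simp only [Sum.inr.injEq, Sum.inl.injEq, Prod.mk.injEq, Fin.mk.injEq] at hp
  rw [← hp.2]
  congr 1
  exact Fin.ext hp.1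

end Necklace

theorem pow_le_planarMaxCopies {k : ℕ} (hk : 3 ≤ k) (t q : ℕ) :
    t ^ (k / 2) ≤ planarMaxCopies (((k - 1) / 2 + 1) * (t + 1) + q) (cycleGraph k) := by
  classical
  set g := (k - 1) / 2 with hg
  set n := (g + 1) * (t + 1) + q with hn
  let e : Fin n ≃ Necklace.Vertex g t q := Fintype.equivOfCardEq (by simp [hn]; ring)
  let G : SimpleGraph (Fin n) := (Necklace.graph g t q).comap e
  let φ : G ≃g Necklace.graph g t q := ⟨e, Iff.rfl⟩
  have hG : G.IsPlanar :=
    (Necklace.isPlanar_graph (by omega)).of_injective φ.toEmbedding.toHom e.injective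
  have h1 : t ^ (k / 2) ≤ G.copyCount (cycleGraph k) := by
    have := card_le_copyCount (G := G)
      (fun σ : Fin (k / 2) → Fin t =>
        φ.symm.toCopy.comp (Necklace.cycleCopy (q := q) hk hg.symm σ)) (by
        intro σ τ h
        simp only [Copy.coe_comp, Set.range_comp] at h
        exact Necklace.range_cycleCopy_injective hk hg.symm
          (Set.image_injective.2 e.symm.injective h))
    simpa using this
  exact h1.trans (Finset.le_sup (f := fun G : SimpleGraph (Fin n) => G.copyCount (cycleGraph k))
    (Finset.mem_filter.2 ⟨Finset.mem_univ _, hG⟩))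

end SimpleGraph

theorem corollary3 (k : ℕ) (hk : 3 ≤ k) :
    (fun n : ℕ => (SimpleGraph.planarMaxCopies n (SimpleGraph.cycleGraph k) : ℝ))
      =Θ[Filter.atTop] (fun n : ℕ => (n : ℝ) ^ (k / 2)) := by
  constructor
  · refine IsBigO.of_bound (2 ^ k * (k * 14) ^ k : ℕ) ?_
    filter_upwards [Filter.eventually_gt_atTop 0] with n hn
    have h := SimpleGraph.planarMaxCopies_cycleGraph_le (by omega : 2 ≤ k) hn
    rw [Real.norm_of_nonneg (by positivity), Real.norm_of_nonneg (by positivity)]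
    exact_mod_cast h
  · set g := (k - 1) / 2 with hg
    refine IsBigO.of_bound ((3 * (g + 1) : ℕ) ^ (k / 2) : ℝ) ?_
    filter_upwards [Filter.eventually_ge_atTop (2 * (g + 1))] with n hn
    obtain ⟨t, q, hq, ht, hnt⟩ : ∃ t q, q < g + 1 ∧ 1 ≤ t ∧ n = (g + 1) * (t + 1) + q := by
      have h1 : 2 ≤ n / (g + 1) := (Nat.le_div_iff_mul_le (by omega)).2 hn
      refine ⟨n / (g + 1) - 1, n % (g + 1), Nat.mod_lt _ (by omega), by omega, ?_⟩
      rw [Nat.sub_add_cancel (by omega), Nat.div_add_mod]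
    have h := SimpleGraph.pow_le_planarMaxCopies hk t q
    rw [← hg, ← hnt] at h
    rw [Real.norm_of_nonneg (by positivity), Real.norm_of_nonneg (by positivity)]
    -- Here `n < (g + 1) * (t + 2)`, and `t + 2 ≤ 3 * t` because `1 ≤ t`.
    have h2 : n ≤ 3 * (g + 1) * t := by nlinarith
    have h3 : n ^ (k / 2) ≤ (3 * (g + 1)) ^ (k / 2) *
        SimpleGraph.planarMaxCopies n (SimpleGraph.cycleGraph k) :=
      calc n ^ (k / 2) ≤ (3 * (g + 1) * t) ^ (k / 2) := Nat.pow_le_pow_left h2 _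
        _ = (3 * (g + 1)) ^ (k / 2) * t ^ (k / 2) := Nat.mul_pow _ _ _
        _ ≤ _ := Nat.mul_le_mul_left _ h
    exact_mod_cast h3
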